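/- Let $a,b\in\mathbb{C}$ with $ab\neq 0$, let $r,s,\alpha$ be integers with $0\le r\le s$ and $\alpha\ge 1$, and let $$F=a\,x^{r}y^{s+\alpha}+b\,x^{r+\alpha}y^{s}\in\mathbb{C}[x,y],$$ a form of degree $d=r+s+\alpha$. The Waring rank $\operatorname{rk}(F)$ is the least number $k$ such that $F=a_1L_1^d+\dots+a_kL_k^d$ for some scalars $a_1,\dots,a_k\in\mathbb{C}$ and linear forms $L_1,\dots,L_k\in\mathbb{C}[x,y]$. Let $q,j$ be the unique nonnegative integers with $r=q\alpha+j$ and $0\le j<\alpha$, and set $\delta=r+\alpha-s$. Then $$\operatorname{rk}(F)=\begin{cases} s+1 & \text{if } \delta\le 0,\\ s+2 & \text{if } \delta>0,\ j=0,\ r=s \text{ and } \alpha>1,\\ s+1 & \text{if } \delta>0 \text{ and } j=\delta,\\ r+\alpha+1 & \text{if } \delta>0 \text{ and } j>\delta,\\ r+\alpha-j & \text{otherwise.} \end{cases}$$ -/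

import Mathlib

/-- `F = a₁ L₁ ^ d + ⋯ + aₖ Lₖ ^ d` for some scalars `a₁, …, aₖ` in the field `K` and some
linear forms `L₁, …, Lₖ` (homogeneous polynomials of degree one) with coefficients in `K`. -/
def HasWaringDecomposition {σ K : Type*} [Field K]
    (d : ℕ) (F : MvPolynomial σ K) (k : ℕ) : Prop :=
  ∃ (a : Fin k → K) (L : Fin k → MvPolynomial σ K),
    (∀ i, (L i).IsHomogeneous 1) ∧ F = ∑ i, MvPolynomial.C (a i) * L i ^ d

/-- `F` is a form of degree `d` and its Waring rank over the field `K` is `k`: `k` is the least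
number of summands in an expression `F = a₁ L₁ ^ d + ⋯ + aₖ Lₖ ^ d`. -/
def IsWaringRank {σ K : Type*} [Field K]
    (d : ℕ) (F : MvPolynomial σ K) (k : ℕ) : Prop :=
  F.IsHomogeneous d ∧ IsLeast {n : ℕ | HasWaringDecomposition d F n} k

/-- The binary binomial form `a x^r y^(s+α) + b x^(r+α) y^s`, with `x = X 0` and `y = X 1`. -/
noncomputable def binomialForm (a b : ℂ) (r s α : ℕ) : MvPolynomial (Fin 2) ℂ :=
  MvPolynomial.C a * MvPolynomial.X 0 ^ r * MvPolynomial.X 1 ^ (s + α) +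
    MvPolynomial.C b * MvPolynomial.X 0 ^ (r + α) * MvPolynomial.X 1 ^ s

/-! By Sylvester's apolarity, `F` is a sum of `k` powers iff a squarefree binary form of some degree
`l ≤ k` annihilates it (`exists_separable_apolar`, `hasWaringDecomposition_of_separable_apolar`). As
`F` has two terms, this says that the coefficients `γ` of the annihilator satisfy `A γ(t - α) + B
γ(t) = 0` on the window `l - s ≤ t ≤ r + α`, a recurrence inside each residue class modulo `α`.

Upper bounds: the geometric series in `(-A/B) X ^ α` of degree `(q + 1)α = r + α - j` satisfies it
for `0 < t ≤ r + α`. It serves alone, with a factor at infinity, or plus a generic multiple of `X ^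
k` with `k > r + α`. The exceptional case takes `X` times a shorter series and a factor at infinity.

Lower bounds: a squarefree form has at most simple zeros at `0` and infinity, so neither `γ 0, γ 1`
nor `γ l, γ (l - 1)` both vanish. If `l` is too small, the zeros of `γ` outside `[0, l]` propagate
through the window and kill one of these pairs. -/

/-- The binary form of degree `d` whose coefficient of `x ^ n * y ^ (d - n)` is
`d.choose n * c n`. -/
noncomputable def binaryForm {K : Type*} [Field K] (d : ℕ) (c : ℕ → K) : MvPolynomial (Fin 2) K :=
  ∑ n ∈ Finset.range (d + 1),
    MvPolynomial.C (d.choose n * c n) * MvPolynomial.X 0 ^ n * MvPolynomial.X 1 ^ (d - n)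

open Polynomial in
/-- The contraction of a binary form with normalized coefficients `c` against a form of the same
degree, given in dehomogenized shape. -/
noncomputable def contraction {K : Type*} [Field K] (d : ℕ) (c : ℕ → K) : K[X] →ₗ[K] K :=
  ∑ n ∈ Finset.range (d + 1), c n • Polynomial.lcoeff K n

/-! ### Sylvester's apolarity for binary forms -/

section Sylvester

variable {K : Type*} [Field K]

open Polynomial

theorem contraction_apply (d : ℕ) (c : ℕ → K) (f : K[X]) :
    contraction d c f = ∑ n ∈ Finset.range (d + 1), c n * f.coeff n := by
  simp [contraction]

theorem contraction_X_pow {d n : ℕ} (c : ℕ → K) (hn : n ≤ d) : contraction d c (X ^ n) = c n := by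
  rw [contraction_apply, Finset.sum_eq_single n]
  · simp
  · intro m _ hm
    simp [coeff_X_pow, hm]
  · intro h
    simp at h
    omega

theorem binaryForm_congr {d : ℕ} {c c' : ℕ → K} (h : ∀ n ≤ d, c n = c' n) :
    binaryForm d c = binaryForm d c' := by
  refine Finset.sum_congr rfl fun n hn => ?_
  rw [h n (by simpa [Nat.lt_succ_iff] using hn)]

theorem linear_pow_eq_binaryForm (d : ℕ) (u v : K) :
    (MvPolynomial.C u * MvPolynomial.X 0 + MvPolynomial.C v * MvPolynomial.X 1) ^ d =
      binaryForm d (fun n => u ^ n * v ^ (d - n)) := by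
  rw [add_pow, binaryForm]
  refine Finset.sum_congr rfl fun n _ => ?_
  simp only [map_mul, map_pow, map_natCast]
  ring

theorem sum_C_mul_binaryForm {ι : Type*} (s : Finset ι) (d : ℕ) (a : ι → K) (c : ι → ℕ → K) :
    ∑ i ∈ s, MvPolynomial.C (a i) * binaryForm d (c i) =
      binaryForm d (fun n => ∑ i ∈ s, a i * c i n) := by
  simp only [binaryForm, Finset.mul_sum, map_mul, map_sum, Finset.sum_mul]
  rw [Finset.sum_comm]
  refine Finset.sum_congr rfl fun n _ => Finset.sum_congr rfl fun i _ => ?_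
  ring

theorem binaryForm_injective [CharZero K] {d : ℕ} {c c' : ℕ → K}
    (h : binaryForm d c = binaryForm d c') {n : ℕ} (hn : n ≤ d) : c n = c' n := by
  have key : ∀ e : ℕ → K,
      (MvPolynomial.aeval ![(X : K[X]), 1] (binaryForm d e)).coeff n = d.choose n * e n := by
    intro e
    simp only [binaryForm, map_sum, map_mul, map_pow, MvPolynomial.aeval_X, Matrix.cons_val_zero,
      Matrix.cons_val_one, one_pow, mul_one, MvPolynomial.aeval_C, Polynomial.algebraMap_eq]
    simp only [← C_mul, finsetSum_coeff, coeff_C_mul_X_pow]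
    rw [Finset.sum_ite_eq, if_pos (by simpa [Nat.lt_succ_iff] using hn)]
  have h1 := key c
  rw [h, key c'] at h1
  exact (mul_left_cancel₀ (Nat.cast_ne_zero.2 (Nat.choose_pos hn).ne') h1).symm

theorem exists_eq_linear_of_isHomogeneous_one {L : MvPolynomial (Fin 2) K}
    (hL : L.IsHomogeneous 1) :
    ∃ u v : K, L = MvPolynomial.C u * MvPolynomial.X 0 + MvPolynomial.C v * MvPolynomial.X 1 := by
  have h : L ∈ Submodule.span K (Set.range (MvPolynomial.X : Fin 2 → MvPolynomial (Fin 2) K)) := by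
    rw [← MvPolynomial.homogeneousSubmodule_one_eq_span_X]
    exact hL
  obtain ⟨w, hw⟩ := (Submodule.mem_span_range_iff_exists_fun K).1 h
  exact ⟨w 0, w 1, by rw [← hw, Fin.sum_univ_two]; simp [MvPolynomial.smul_eq_C_mul]⟩

theorem isHomogeneous_linear (u v : K) :
    (MvPolynomial.C u * MvPolynomial.X 0 + MvPolynomial.C v * MvPolynomial.X 1 :
      MvPolynomial (Fin 2) K).IsHomogeneous 1 :=
  (MvPolynomial.isHomogeneous_C_mul_X u 0).add (MvPolynomial.isHomogeneous_C_mul_X v 1)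

theorem hasWaringDecomposition_binaryForm_iff [CharZero K] {d k : ℕ} {c : ℕ → K} :
    HasWaringDecomposition d (binaryForm d c) k ↔
      ∃ a u v : Fin k → K, ∀ n ≤ d, c n = ∑ i, a i * (u i ^ n * v i ^ (d - n)) := by
  constructor
  · rintro ⟨a, L, hL, hF⟩
    choose u v huv using fun i => exists_eq_linear_of_isHomogeneous_one (hL i)
    refine ⟨a, u, v, fun n hn => ?_⟩
    simp only [huv, linear_pow_eq_binaryForm, sum_C_mul_binaryForm] at hF
    exact binaryForm_injective hF hn
  · rintro ⟨a, u, v, h⟩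
    refine ⟨a, fun i => MvPolynomial.C (u i) * MvPolynomial.X 0 +
      MvPolynomial.C (v i) * MvPolynomial.X 1, fun i => isHomogeneous_linear _ _, ?_⟩
    simp only [linear_pow_eq_binaryForm, sum_C_mul_binaryForm]
    exact binaryForm_congr h

theorem sum_coeff_mul_pow_mul_pow {d : ℕ} {f : K[X]} (hf : f.natDegree ≤ d) (u : K) {v : K}
    (hv : v ≠ 0) :
    ∑ n ∈ Finset.range (d + 1), u ^ n * v ^ (d - n) * f.coeff n = v ^ d * f.eval (u / v) := by
  rw [eval_eq_sum_range' (Nat.lt_succ_of_le hf), Finset.mul_sum]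
  refine Finset.sum_congr rfl fun n hn => ?_
  have hn : n ≤ d := by simpa [Nat.lt_succ_iff] using hn
  rw [← Nat.sub_add_cancel hn, pow_add, div_pow, Nat.add_sub_cancel]
  field_simp

/-- A decomposition into powers of linear forms yields a form without multiple factors which is
apolar to the given one; `ε` is the multiplicity of the factor at infinity. -/
theorem exists_separable_apolar [CharZero K] {d k : ℕ} {c : ℕ → K}
    (h : HasWaringDecomposition d (binaryForm d c) k) :
    ∃ (g : K[X]) (ε : ℕ), g.Separable ∧ ε ≤ 1 ∧ g.natDegree + ε ≤ k ∧
      ∀ m, m + (g.natDegree + ε) ≤ d → contraction d c (X ^ m * g) = 0 := by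
  classical
  obtain ⟨a, u, v, hc⟩ := hasWaringDecomposition_binaryForm_iff.1 h
  -- Forms with `v i ≠ 0` give finite roots `u i / v i`; equal ratios are merged, so the roots are
  -- simple.
  set T : Finset (Fin k) := Finset.univ.filter fun i => v i ≠ 0 with hT
  set S : Finset K := T.image fun i => u i / v i with hS
  have hTk : T.card ≤ k := by simpa using Finset.card_le_univ T
  obtain ⟨ε, hε, hε1, hεk⟩ : ∃ ε : ℕ, ε ≤ 1 ∧ ((∃ i, v i = 0) → ε = 1) ∧ T.card + ε ≤ k := by
    by_cases hi : ∃ i, v i = 0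
    · refine ⟨1, le_rfl, fun _ => rfl, ?_⟩
      obtain ⟨i, hi⟩ := hi
      have : T.card < (Finset.univ : Finset (Fin k)).card :=
        Finset.card_lt_card (Finset.ssubset_univ_iff.2 fun h => by
          have := Finset.mem_univ i
          rw [← h] at this
          simp [hT, hi] at this)
      simpa using this
    · exact ⟨0, by simp, fun h => absurd h hi, by simpa using hTk⟩
  have hdeg : (Lagrange.nodal S id).natDegree = S.card := Lagrange.natDegree_nodal
  refine ⟨Lagrange.nodal S id, ε, ?_, hε, ?_, fun m hm => ?_⟩
  · rw [Lagrange.nodal_eq, separable_prod_X_sub_C_iff']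
    simp
  · have : S.card ≤ T.card := Finset.card_image_le
    omega
  · set f := X ^ m * Lagrange.nodal S id with hf
    have hfd : f.natDegree + ε ≤ d := by
      have : f.natDegree ≤ m + S.card := by
        rw [← hdeg]
        exact natDegree_mul_le.trans (by simp)
      omega
    rw [contraction_apply]
    have hsum : ∑ n ∈ Finset.range (d + 1), c n * f.coeff n =
        ∑ i, a i * ∑ n ∈ Finset.range (d + 1), u i ^ n * v i ^ (d - n) * f.coeff n := by
      simp only [Finset.mul_sum]
      rw [Finset.sum_comm]
      refine Finset.sum_congr rfl fun n hn => ?_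
      rw [hc n (by simpa [Nat.lt_succ_iff] using hn), Finset.sum_mul]
      simp only [mul_assoc]
    rw [hsum]
    refine Finset.sum_eq_zero fun i _ => ?_
    by_cases hi : v i = 0
    · have := hε1 ⟨i, hi⟩
      rw [Finset.sum_eq_zero, mul_zero]
      intro n hn
      have hn : n ≤ d := by simpa [Nat.lt_succ_iff] using hn
      rcases hn.eq_or_lt with rfl | hn
      · rw [coeff_eq_zero_of_natDegree_lt (by omega), mul_zero]
      · rw [hi, zero_pow (by omega), mul_zero, zero_mul]
    · rw [sum_coeff_mul_pow_mul_pow (by omega) _ hi, hf, eval_mul,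
        show u i / v i = id (u i / v i) from rfl, Lagrange.eval_nodal_at_node, mul_zero, mul_zero,
        mul_zero]
      exact Finset.mem_image_of_mem _ (by simp [hT, hi])

/-- Modulo the nodal polynomial, `X ^ n` is its Lagrange interpolant, so the weights are the
contractions of the Lagrange basis. -/
theorem exists_eq_sum_pow_of_contraction_nodal {d N : ℕ} {c : ℕ → K} {S : Finset K}
    (h : ∀ m, m + S.card < N → contraction d c (X ^ m * Lagrange.nodal S id) = 0) :
    ∃ w : K → K, ∀ n < N, n ≤ d → c n = ∑ ρ ∈ S, w ρ * ρ ^ n := by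
  classical
  set P : K[X] := Lagrange.nodal S id with hP
  have hPm : P.Monic := Lagrange.nodal_monic
  refine ⟨fun ρ => contraction d c (Lagrange.basis S id ρ), fun n hN hn => ?_⟩
  have hPd : P.natDegree = S.card := Lagrange.natDegree_nodal
  have hmul : ∀ f : K[X], f.natDegree + S.card < N → contraction d c (f * P) = 0 := by
    intro f hf
    rw [f.as_sum_range, Finset.sum_mul, map_sum]
    refine Finset.sum_eq_zero fun m hm => ?_
    have hm : m ≤ f.natDegree := by simpa [Nat.lt_succ_iff] using hm
    rw [← C_mul_X_pow_eq_monomial, mul_assoc, ← smul_eq_C_mul, map_smul, h m (by omega), smul_zero]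
  have hq : contraction d c ((X ^ n /ₘ P) * P) = 0 := by
    rcases le_or_gt S.card n with hSn | hSn
    · apply hmul
      rw [natDegree_divByMonic _ hPm, natDegree_X_pow, hPd]
      omega
    · rw [(divByMonic_eq_zero_iff hPm).2, zero_mul, map_zero]
      rw [degree_X_pow, Lagrange.degree_nodal]
      exact_mod_cast hSn
  have hr : X ^ n %ₘ P = Lagrange.interpolate S id fun ρ => ρ ^ n := by
    refine Lagrange.eq_interpolate_of_eval_eq _ Function.injective_id.injOn ?_ fun ρ hρ => ?_
    · rw [← Lagrange.degree_nodal (v := id)]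
      exact degree_modByMonic_lt _ hPm
    · have h0 : P.eval ρ = 0 := Lagrange.eval_nodal_at_node (v := id) hρ
      have := congrArg (eval ρ) (modByMonic_add_div (X ^ n : K[X]) P)
      simpa [h0] using this
  rw [← contraction_X_pow c hn, ← modByMonic_add_div (X ^ n : K[X]) P, map_add, mul_comm P, hq,
    add_zero, hr, Lagrange.interpolate_apply, map_sum]
  refine Finset.sum_congr rfl fun ρ _ => ?_
  rw [← smul_eq_C_mul, map_smul, smul_eq_mul, mul_comm]

/-- An apolar form without multiple factors yields a decomposition into powers of linear forms;
`ε` is the multiplicity of its factor at infinity. -/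
theorem hasWaringDecomposition_of_separable_apolar [CharZero K] [IsAlgClosed K] {d ε : ℕ}
    {c : ℕ → K} {g : K[X]} (hg : g.Separable) (hε : ε ≤ 1)
    (h : ∀ m, m + (g.natDegree + ε) ≤ d → contraction d c (X ^ m * g) = 0) :
    HasWaringDecomposition d (binaryForm d c) (g.natDegree + ε) := by
  classical
  have hsplit : g.Splits := IsAlgClosed.splits g
  set S := g.roots.toFinset with hS
  have hcard : S.card = g.natDegree := by
    rw [hS, Multiset.toFinset_card_of_nodup (nodup_roots hg), hsplit.natDegree_eq_card_roots]
  have hgS : g = C g.leadingCoeff * Lagrange.nodal S id := by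
    conv_lhs => rw [hsplit.eq_prod_roots]
    rw [Lagrange.nodal_eq, Finset.prod, hS, Multiset.toFinset_val,
      (nodup_roots hg).dedup]
    rfl
  have hlead : g.leadingCoeff ≠ 0 := leadingCoeff_ne_zero.2 hg.ne_zero
  obtain ⟨w, hw⟩ := exists_eq_sum_pow_of_contraction_nodal (d := d) (N := d + 1 - ε) (c := c)
    (S := S) fun m hm => by
      have := h m (by omega)
      rw [hgS, mul_left_comm, ← smul_eq_C_mul, map_smul, smul_eq_mul] at this
      exact (mul_eq_zero.1 this).resolve_left hlead
  rw [← hcard]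
  let e := S.equivFin
  have hsum : ∀ n, ∑ i, w (e.symm i) * ((e.symm i : K) ^ n) = ∑ ρ ∈ S, w ρ * ρ ^ n := by
    intro n
    rw [Equiv.sum_comp e.symm fun ρ : S => w ρ * (ρ : K) ^ n]
    exact Finset.sum_coe_sort S fun ρ => w ρ * ρ ^ n
  rw [hasWaringDecomposition_binaryForm_iff]
  obtain rfl | rfl : ε = 0 ∨ ε = 1 := by omega
  · refine ⟨fun i => w (e.symm i), fun i => e.symm i, fun _ => 1, fun n hn => ?_⟩
    simp only [one_pow, mul_one]
    rw [hw n (by omega) hn]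
    exact (hsum n).symm
  -- The form `x` accounts for infinity: `x ^ d` affects only `c d`, the one coefficient not yet
  -- matched.
  · refine ⟨Fin.snoc (fun i => w (e.symm i)) (c d - ∑ ρ ∈ S, w ρ * ρ ^ d),
      Fin.snoc (fun i => (e.symm i : K)) 1, Fin.snoc (fun _ => 1) 0, fun n hn => ?_⟩
    simp only [Fin.sum_univ_castSucc, Fin.snoc_castSucc, Fin.snoc_last, one_pow, mul_one, one_mul]
    rw [hsum]
    rcases hn.eq_or_lt with rfl | hn
    · simp
    · rw [zero_pow (by omega), mul_zero, add_zero, hw n (by omega) hn.le]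

end Sylvester

/-! ### Separable pencils and truncated geometric series -/

section Pencil

open Polynomial

variable {K : Type*} [Field K]

theorem separable_of_eval_derivative_ne_zero [IsAlgClosed K] {f : K[X]}
    (h : ∀ x, f.eval x = 0 → f.derivative.eval x ≠ 0) : f.Separable := by
  rw [separable_def, isCoprime_iff_aeval_ne_zero_of_isAlgClosed K K]
  intro x
  by_cases hx : f.eval x = 0
  · exact Or.inr (by simpa using h x hx)
  · exact Or.inl (by simpa using hx)

/-- A general member of the pencil spanned by `p` and `X ^ k` is separable, if `p` has nonzero
constant coefficient and degree less than `k`. -/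
theorem exists_separable_add_C_mul_X_pow [CharZero K] [IsAlgClosed K] {p : K[X]} {k : ℕ}
    (h0 : p.coeff 0 ≠ 0) (hk : p.natDegree < k) :
    ∃ c : K, c ≠ 0 ∧ (p + C c * X ^ k).Separable := by
  classical
  -- A double root of `p + c X ^ k` is a root of `W` and determines `c`, so only finitely many `c`
  -- are bad.
  set W : K[X] := X * derivative p - (k : K[X]) * p with hW
  have hWne : W ≠ 0 := by
    intro h
    have : W.coeff 0 = 0 := by rw [h, coeff_zero]
    rw [hW, coeff_sub, coeff_X_mul_zero, coeff_natCast_mul, zero_sub, neg_eq_zero] at this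
    exact (mul_ne_zero (Nat.cast_ne_zero.2 (by omega)) h0) this
  obtain ⟨c, hc⟩ := Infinite.exists_notMem_finset
    (insert (0 : K) (W.roots.toFinset.image fun x => -p.eval x / x ^ k))
  simp only [Finset.mem_insert, Finset.mem_image, Multiset.mem_toFinset, not_or, not_exists,
    not_and] at hc
  refine ⟨c, hc.1, separable_of_eval_derivative_ne_zero fun x hx hx' => ?_⟩
  have hx0 : x ≠ 0 := by
    rintro rfl
    rw [eval_add, eval_mul, eval_pow, eval_X, zero_pow (by omega), mul_zero, add_zero,
      ← coeff_zero_eq_eval_zero] at hx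
    exact h0 hx
  simp only [eval_add, eval_mul, eval_C, eval_pow, eval_X, derivative_add, derivative_C_mul,
    derivative_X_pow, map_natCast, eval_natCast] at hx hx'
  refine hc.2 x ?_ ?_
  · rw [mem_roots hWne, IsRoot.def, hW]
    simp only [eval_sub, eval_mul, eval_X, eval_natCast]
    have hxk : x ^ k = x ^ (k - 1) * x := by
      rw [← pow_succ, Nat.sub_add_cancel (by omega)]
    rw [hxk] at hx
    linear_combination x * hx' - (k : K) * hx
  · rw [div_eq_iff (pow_ne_zero _ hx0)]
    linear_combination -hx

/-- The truncated geometric series `1 + z X ^ α + ⋯ + (z X ^ α) ^ n`. -/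
noncomputable def geomPoly (z : K) (α n : ℕ) : K[X] :=
  ∑ i ∈ Finset.range (n + 1), (C z * X ^ α) ^ i

theorem geomPoly_mul (z : K) (α n : ℕ) :
    geomPoly z α n * (C z * X ^ α - 1) = C (z ^ (n + 1)) * X ^ (α * (n + 1)) - 1 := by
  rw [geomPoly, geom_sum_mul, mul_pow, C_pow, pow_mul]

theorem coeff_geomPoly_add (z : K) {α n t : ℕ} (hα : 1 ≤ α) (ht : t ≠ n * α) :
    (geomPoly z α n).coeff (t + α) = z * (geomPoly z α n).coeff t := by
  have h := congrArg (coeff · (t + α)) (geomPoly_mul z α n)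
  simp only [mul_sub, mul_one, coeff_sub, ← mul_assoc, coeff_mul_X_pow, coeff_C_mul_X_pow,
    coeff_one] at h
  rw [if_neg, if_neg (by omega), mul_comm, coeff_C_mul] at h
  · linear_combination -h
  · intro h'
    apply ht
    have : t + α = n * α + α := by rw [h']; ring
    omega

theorem coeff_geomPoly_of_lt (z : K) {α n t : ℕ} (ht : 0 < t) (htα : t < α) :
    (geomPoly z α n).coeff t = 0 := by
  have h := congrArg (coeff · t) (geomPoly_mul z α n)
  simp only [mul_sub, mul_one, coeff_sub, ← mul_assoc, coeff_mul_X_pow', coeff_one] at h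
  rw [if_neg (by omega), if_neg, if_neg (by omega)] at h
  · linear_combination -h
  · have : α ≤ α * (n + 1) := Nat.le_mul_of_pos_right _ (by omega)
    omega

theorem coeff_zero_geomPoly (z : K) {α n : ℕ} (hα : 1 ≤ α) : (geomPoly z α n).coeff 0 = 1 := by
  have h := congrArg (eval 0) (geomPoly_mul z α n)
  have hα' : α ≠ 0 := by omega
  have hα'' : α * (n + 1) ≠ 0 := by positivity
  simp only [eval_mul, eval_sub, eval_C, eval_pow, eval_X, eval_one, zero_pow hα', zero_pow hα'',
    mul_zero] at h
  rw [coeff_zero_eq_eval_zero]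
  linear_combination -h

theorem natDegree_geomPoly {z : K} (hz : z ≠ 0) {α n : ℕ} (hα : 1 ≤ α) :
    (geomPoly z α n).natDegree = n * α := by
  have hd : ∀ (w : K) (m : ℕ), w ≠ 0 → 0 < m → (C w * X ^ m - 1 : K[X]).natDegree = m := by
    intro w m hw hm
    rw [← C_1, natDegree_sub_C, natDegree_C_mul_X_pow _ _ hw]
  have h := congrArg natDegree (geomPoly_mul z α n)
  have hne : geomPoly z α n ≠ 0 := fun h => by
    have := coeff_zero_geomPoly z (n := n) hα
    simp [h] at this
  have hne' : (C z * X ^ α - 1 : K[X]) ≠ 0 := fun h => by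
    have := hd z α hz hα
    rw [h, natDegree_zero] at this
    omega
  rw [natDegree_mul hne hne', hd z α hz hα, hd _ _ (pow_ne_zero _ hz) (by positivity)] at h
  have : α * (n + 1) = n * α + α := by ring
  omega

/-- The series divides a binomial `w X ^ N - 1` with `w ≠ 0`. -/
theorem separable_geomPoly [CharZero K] {z : K} (hz : z ≠ 0) {α n : ℕ} (hα : 1 ≤ α) :
    (geomPoly z α n).Separable := by
  have hz' : z ^ (n + 1) ≠ 0 := pow_ne_zero _ hz
  have h : (X ^ (α * (n + 1)) - C (z ^ (n + 1))⁻¹ : K[X]).Separable :=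
    separable_X_pow_sub_C _ (Nat.cast_ne_zero.2 (by positivity)) (inv_ne_zero hz')
  refine h.of_dvd ⟨(C z * X ^ α - 1) * C (z ^ (n + 1))⁻¹, ?_⟩
  rw [← mul_assoc, geomPoly_mul, sub_mul, mul_right_comm, ← C_mul, mul_inv_cancel₀ hz', C_1,
    one_mul, one_mul]

theorem separable_X_mul {f : K[X]} (hf : f.Separable) (h0 : f.coeff 0 ≠ 0) :
    (X * f).Separable := by
  refine separable_X.mul hf ?_
  rw [irreducible_X.coprime_iff_not_dvd, X_dvd_iff]
  exact h0

theorem Polynomial.Separable.coeff_zero_ne_zero_or {f : K[X]} (hf : f.Separable) :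
    f.coeff 0 ≠ 0 ∨ f.coeff 1 ≠ 0 := by
  by_contra! h
  have h1 : eval 0 f = 0 := by rw [← coeff_zero_eq_eval_zero, h.1]
  have h2 : eval 0 (derivative f) = 0 := by
    rw [← coeff_zero_eq_eval_zero, coeff_derivative]; simp [h.2]
  obtain ⟨u, v, huv⟩ := hf
  simpa [h1, h2] using congrArg (eval 0) huv

end Pencil

/-! ### Lower bounds from the recurrence -/

section LowerBound

variable {K : Type*} [Field K] {A B : K} {γ : ℤ → K} {r s α q j k : ℕ}

/-- Zeros propagate upwards from the negative index `c - α`, dividing by `B`. -/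
theorem eq_zero_of_residue_gt (hB : B ≠ 0) (hneg : ∀ t < 0, γ t = 0)
    (hrec : ∀ t : ℤ, (k : ℤ) - s ≤ t → t ≤ r + α → A * γ (t - α) + B * γ t = 0)
    {c : ℤ} (hc : (k : ℤ) - s ≤ c) (hcα : c < α) (i : ℕ) (hi : c + i * α ≤ r + α) :
    γ (c + i * α) = 0 := by
  induction i with
  | zero =>
    have h := hrec c hc (by simpa using hi)
    rw [hneg (c - α) (by omega), mul_zero, zero_add] at h
    simpa using (mul_eq_zero.1 h).resolve_left hB
  | succ i ih =>
    push_cast at hi ⊢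
    have e : (c + ((i : ℤ) + 1) * α) = c + i * α + α := by ring
    have hnn : (0 : ℤ) ≤ i * α := by positivity
    rw [e] at hi ⊢
    have h := hrec (c + i * α + α) (by omega) hi
    rw [add_sub_cancel_right, ih (by omega), mul_zero, zero_add] at h
    exact (mul_eq_zero.1 h).resolve_left hB

/-- Zeros propagate downwards from `c + (q + 1)α > k`, dividing by `A`; `c ≤ j` keeps the steps
below `r + α`. -/
theorem eq_zero_of_residue_le (hA : A ≠ 0) (hr : r = q * α + j) (hpos : ∀ t > (k : ℤ), γ t = 0)
    (hrec : ∀ t : ℤ, (k : ℤ) - s ≤ t → t ≤ r + α → A * γ (t - α) + B * γ t = 0)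
    (hk : k < (q + 1) * α) (hks : k ≤ s + α) {c : ℕ} (hc : c ≤ j) : γ c = 0 := by
  suffices h : ∀ i n : ℕ, i + n = q + 1 → γ (c + n * α) = 0 by simpa using h (q + 1) 0 rfl
  intro i
  induction i with
  | zero =>
    intro n hn
    rw [zero_add] at hn
    subst hn
    apply hpos
    have : (k : ℤ) < ((q + 1 : ℕ) : ℤ) * α := by exact_mod_cast hk
    omega
  | succ i ih =>
    intro n hn
    have hnq : (n : ℤ) * α ≤ q * α := by
      have : n ≤ q := by omega
      exact_mod_cast Nat.mul_le_mul_right α this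
    have hnn : (0 : ℤ) ≤ n * α := by positivity
    have hr' : (r : ℤ) = q * α + j := by exact_mod_cast hr
    have h := hrec (c + n * α + α) (by omega) (by omega)
    have h' := ih (n + 1) (by omega)
    push_cast at h'
    rw [show (c : ℤ) + n * α + α = c + (n + 1) * α by ring, h', mul_zero, add_zero,
      show (c : ℤ) + (n + 1) * α - α = c + n * α by ring] at h
    exact (mul_eq_zero.1 h).resolve_left hA

theorem succ_le_of_recurrence (hB : B ≠ 0) (hα : 1 ≤ α) (hneg : ∀ t < 0, γ t = 0)
    (h0 : γ 0 ≠ 0 ∨ γ 1 ≠ 0)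
    (hrec : ∀ t : ℤ, (k : ℤ) - s ≤ t → t ≤ r + α → A * γ (t - α) + B * γ t = 0) :
    s + 1 ≤ k := by
  by_contra! hk
  have h00 : γ 0 = 0 := by
    simpa using eq_zero_of_residue_gt hB hneg hrec (c := 0) (by omega) (by omega) 0 (by simp; omega)
  have h01 : γ 1 = 0 := by
    have h := hrec 1 (by omega) (by omega)
    have : γ (1 - α) = 0 := by
      obtain rfl | h2 : α = 1 ∨ 1 < α := by omega
      · simpa using h00
      · exact hneg _ (by omega)
    rw [this, mul_zero, zero_add] at h
    exact (mul_eq_zero.1 h).resolve_left hB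
  tauto

/-- Since `(q + 1)α < s`, the upward chains ending at `k` and `k - 1` stay in the window if `k ≤ r +
α`. -/
theorem add_succ_le_of_recurrence (hB : B ≠ 0) (hj : j < α)
    (hr : r = q * α + j) (hδj : r + α < s + j) (hneg : ∀ t < 0, γ t = 0)
    (hk : γ k ≠ 0 ∨ γ (k - 1) ≠ 0)
    (hrec : ∀ t : ℤ, (k : ℤ) - s ≤ t → t ≤ r + α → A * γ (t - α) + B * γ t = 0) :
    r + α + 1 ≤ k := by
  by_contra! hlt
  have hr' : (r : ℤ) = q * α + j := by exact_mod_cast hr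
  have e : ((q + 1 : ℕ) : ℤ) * α = q * α + α := by push_cast; ring
  have h1 := eq_zero_of_residue_gt hB hneg hrec (c := (k : ℤ) - (q + 1 : ℕ) * α)
    (by omega) (by omega) (q + 1) (by omega)
  have h2 := eq_zero_of_residue_gt hB hneg hrec (c := (k : ℤ) - 1 - (q + 1 : ℕ) * α)
    (by omega) (by omega) (q + 1) (by omega)
  rw [sub_add_cancel] at h1 h2
  tauto

/-- For `j > 0` descent kills `γ 0` and `γ 1`. For `j = 0` ascent kills `γ k` and `γ (k - 1)`; this
needs `r < s`, and `r = s` would force `α = 1`, against `s + 1 ≤ k`. -/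
theorem sub_le_of_recurrence (hA : A ≠ 0) (hB : B ≠ 0) (hrs : r ≤ s) (hj : j < α)
    (hr : r = q * α + j) (hδj : s + j < r + α) (hspecial : ¬(j = 0 ∧ r = s ∧ 1 < α))
    (hneg : ∀ t < 0, γ t = 0) (hpos : ∀ t > (k : ℤ), γ t = 0)
    (h0 : γ 0 ≠ 0 ∨ γ 1 ≠ 0) (hk : γ k ≠ 0 ∨ γ (k - 1) ≠ 0) (hs : s + 1 ≤ k)
    (hrec : ∀ t : ℤ, (k : ℤ) - s ≤ t → t ≤ r + α → A * γ (t - α) + B * γ t = 0) :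
    r + α - j ≤ k := by
  by_contra! hlt
  have hq : (q + 1) * α = q * α + α := by ring
  have h00 := eq_zero_of_residue_le (s := s) hA hr hpos hrec (by omega) (by omega) (c := 0)
    (by omega)
  rcases Nat.eq_zero_or_pos j with rfl | hj0
  · have hr' : (r : ℤ) = q * α := by exact_mod_cast hr
    have h1 := eq_zero_of_residue_gt hB hneg hrec (c := (k : ℤ) - q * α)
      (by omega) (by omega) q (by omega)
    have h2 := eq_zero_of_residue_gt hB hneg hrec (c := (k : ℤ) - 1 - q * α)
      (by omega) (by omega) q (by omega)
    rw [sub_add_cancel] at h1 h2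
    tauto
  · have h01 := eq_zero_of_residue_le (s := s) hA hr hpos hrec (by omega) (by omega) (c := 1)
      (by omega)
    simp only [Nat.cast_zero, Nat.cast_one] at h00 h01
    tauto

/-- If `k = s + 1`, descent kills `γ 0`, and `t = 1` kills `γ 1` because `1 - α < 0`. -/
theorem add_two_le_of_recurrence (hA : A ≠ 0) (hB : B ≠ 0) (hα : 1 < α)
    (hr : s = q * α) (hneg : ∀ t < 0, γ t = 0) (hpos : ∀ t > (k : ℤ), γ t = 0)
    (h0 : γ 0 ≠ 0 ∨ γ 1 ≠ 0) (hs : s + 1 ≤ k)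
    (hrec : ∀ t : ℤ, (k : ℤ) - s ≤ t → t ≤ s + α → A * γ (t - α) + B * γ t = 0) :
    s + 2 ≤ k := by
  by_contra! hlt
  have hq : (q + 1) * α = q * α + α := by ring
  have h00 := eq_zero_of_residue_le (s := s) (j := 0) hA hr hpos hrec (by omega) (by omega)
    (c := 0) le_rfl
  have h01 := eq_zero_of_residue_gt hB hneg hrec (c := 1) (by omega) (by omega) 0 (by simp; omega)
  simp only [Nat.cast_zero, zero_mul, add_zero] at h00 h01
  tauto

end LowerBound

/-! ### Annihilators of the binomial form -/

section BinomialForm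

open Polynomial

variable {a b : ℂ} {r s α q j : ℕ}

theorem binomialForm_eq_binaryForm (a b : ℂ) (r s : ℕ) {α : ℕ} (hα : 1 ≤ α) :
    binomialForm a b r s α = binaryForm (r + s + α) (fun n =>
      if n = r then a / (r + s + α).choose r
      else if n = r + α then b / (r + s + α).choose (r + α) else 0) := by
  have hA : ((r + s + α).choose r : ℂ) ≠ 0 :=
    Nat.cast_ne_zero.2 (Nat.choose_pos (by omega)).ne'
  have hB : ((r + s + α).choose (r + α) : ℂ) ≠ 0 :=
    Nat.cast_ne_zero.2 (Nat.choose_pos (by omega)).ne'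
  rw [binomialForm, binaryForm, Finset.sum_eq_add (a := r) (b := r + α)]
  · rw [if_pos rfl, if_neg (by omega), if_pos rfl, mul_div_cancel₀ _ hA, mul_div_cancel₀ _ hB,
      show r + s + α - r = s + α by omega, show r + s + α - (r + α) = s by omega]
  · omega
  · intro n _ hn
    simp [hn.1, hn.2]
  · intro h
    exact absurd (Finset.mem_range.2 (by omega)) h
  · intro h
    exact absurd (Finset.mem_range.2 (by omega)) h

theorem isHomogeneous_binomialForm (a b : ℂ) (r s α : ℕ) :
    (binomialForm a b r s α).IsHomogeneous (r + s + α) := by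
  have h : ∀ (c : ℂ) (m n : ℕ), (MvPolynomial.C c * MvPolynomial.X 0 ^ m * MvPolynomial.X 1 ^ n :
      MvPolynomial (Fin 2) ℂ).IsHomogeneous (m + n) := fun c m n =>
    (MvPolynomial.isHomogeneous_C_mul_X_pow c 0 m).mul (MvPolynomial.isHomogeneous_X_pow 1 n)
  refine MvPolynomial.IsHomogeneous.add ?_ ?_
  · convert h a r (s + α) using 1; ring
  · convert h b (r + α) s using 1; ring

theorem contraction_two_terms (A B : ℂ) (r s : ℕ) {α : ℕ} (hα : 1 ≤ α) (f : ℂ[X]) :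
    contraction (r + s + α) (fun n => if n = r then A else if n = r + α then B else 0) f =
      A * f.coeff r + B * f.coeff (r + α) := by
  rw [contraction_apply, Finset.sum_eq_add (a := r) (b := r + α)]
  · rw [if_pos rfl, if_neg (by omega), if_pos rfl]
  · omega
  · intro n _ hn
    simp [hn.1, hn.2]
  · intro h
    exact absurd (Finset.mem_range.2 (by omega)) h
  · intro h
    exact absurd (Finset.mem_range.2 (by omega)) h

/-- The apolarity criterion for decompositions of binomial forms. -/
theorem exists_apolarity_binomialForm (hab : a * b ≠ 0) (r s : ℕ) (hα : 1 ≤ α) :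
    ∃ A B : ℂ, A ≠ 0 ∧ B ≠ 0 ∧
      (∀ (g : ℂ[X]) (ε : ℕ), g.Separable → ε ≤ 1 →
        (∀ m, m + (g.natDegree + ε) ≤ r + s + α →
          A * (X ^ m * g).coeff r + B * (X ^ m * g).coeff (r + α) = 0) →
        HasWaringDecomposition (r + s + α) (binomialForm a b r s α) (g.natDegree + ε)) ∧
      ∀ k, HasWaringDecomposition (r + s + α) (binomialForm a b r s α) k →
        ∃ (g : ℂ[X]) (ε : ℕ), g.Separable ∧ ε ≤ 1 ∧ g.natDegree + ε ≤ k ∧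
          ∀ m, m + (g.natDegree + ε) ≤ r + s + α →
            A * (X ^ m * g).coeff r + B * (X ^ m * g).coeff (r + α) = 0 := by
  refine ⟨a / (r + s + α).choose r, b / (r + s + α).choose (r + α),
    div_ne_zero (left_ne_zero_of_mul hab) (Nat.cast_ne_zero.2 (Nat.choose_pos (by omega)).ne'),
    div_ne_zero (right_ne_zero_of_mul hab) (Nat.cast_ne_zero.2 (Nat.choose_pos (by omega)).ne'),
    ?_, ?_⟩
  · intro g ε hg hε h
    rw [binomialForm_eq_binaryForm a b r s hα]
    refine hasWaringDecomposition_of_separable_apolar hg hε fun m hm => ?_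
    rw [contraction_two_terms _ _ _ _ hα]
    exact h m hm
  · intro k hk
    rw [binomialForm_eq_binaryForm a b r s hα] at hk
    obtain ⟨g, ε, hg, hε, hgk, h⟩ := exists_separable_apolar hk
    refine ⟨g, ε, hg, hε, hgk, fun m hm => ?_⟩
    rw [← contraction_two_terms _ _ _ s hα]
    exact h m hm

/-- The series breaks the recurrence only at `t = 0` and `t = (q + 2)α`, and the latter exceeds `r +
α`. -/
theorem geomPoly_apolar {A B : ℂ} (hB : B ≠ 0) (hα : 1 ≤ α) (hr : r = q * α + j) (hj : j < α)
    {m : ℕ} (hm : m < r + α) :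
    A * (X ^ m * geomPoly (-A / B) α (q + 1)).coeff r +
      B * (X ^ m * geomPoly (-A / B) α (q + 1)).coeff (r + α) = 0 := by
  have hq : (q + 1) * α = q * α + α := by ring
  rw [coeff_X_pow_mul', coeff_X_pow_mul', if_pos hm.le]
  split_ifs with h
  · rw [show r + α - m = r - m + α by omega, coeff_geomPoly_add _ hα (by omega)]
    field_simp
    ring
  · rw [coeff_geomPoly_of_lt _ (by omega) (by omega)]
    simp

theorem X_mul_geomPoly_apolar {A B : ℂ} (hB : B ≠ 0) (hα : 1 < α) {m : ℕ}
    (hm : m + 2 ≤ q * α + α) :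
    A * (X ^ m * (X * geomPoly (-A / B) α q)).coeff (q * α) +
      B * (X ^ m * (X * geomPoly (-A / B) α q)).coeff (q * α + α) = 0 := by
  rw [← mul_assoc, ← pow_succ, coeff_X_pow_mul', coeff_X_pow_mul',
    if_pos (show m + 1 ≤ q * α + α by omega)]
  split_ifs with h
  · rw [show q * α + α - (m + 1) = q * α - (m + 1) + α by omega,
      coeff_geomPoly_add _ hα.le (by omega)]
    field_simp
    ring
  · rw [coeff_geomPoly_of_lt _ (by omega) (by omega)]
    simp

theorem hasWaringDecomposition_of_generic (hab : a * b ≠ 0) (hα : 1 ≤ α) (hr : r = q * α + j)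
    (hj : j < α) {k : ℕ} (hks : s + 1 ≤ k) (hkr : r + α + 1 ≤ k) :
    HasWaringDecomposition (r + s + α) (binomialForm a b r s α) k := by
  obtain ⟨A, B, hA, hB, h, -⟩ := exists_apolarity_binomialForm hab r s hα
  have hq : (q + 1) * α = q * α + α := by ring
  have hz : -A / B ≠ 0 := div_ne_zero (neg_ne_zero.2 hA) hB
  set p := geomPoly (-A / B) α (q + 1) with hp
  have hd : p.natDegree < k := by
    rw [hp, natDegree_geomPoly hz hα]
    omega
  obtain ⟨c, hc, hsep⟩ := exists_separable_add_C_mul_X_pow (p := p) (k := k)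
    (by rw [hp, coeff_zero_geomPoly _ hα]; exact one_ne_zero) hd
  have hdeg : (p + C c * X ^ k).natDegree = k := by
    rw [natDegree_add_eq_right_of_natDegree_lt] <;> rw [natDegree_C_mul_X_pow _ _ hc]
    exact hd
  have := h (p + C c * X ^ k) 0 hsep (by omega) fun m hm => ?_
  · rwa [hdeg, add_zero] at this
  · rw [hdeg] at hm
    rw [mul_add, coeff_add, coeff_add, mul_left_comm, ← pow_add, coeff_C_mul_X_pow,
      coeff_C_mul_X_pow, if_neg (by omega), if_neg (by omega), add_zero, add_zero]
    exact geomPoly_apolar hB hα hr hj (by omega)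

theorem hasWaringDecomposition_geomPoly (hab : a * b ≠ 0) (hα : 1 ≤ α) (hr : r = q * α + j)
    (hj : j < α) {ε : ℕ} (hε : ε ≤ 1) (hk : s + 1 ≤ (q + 1) * α + ε) :
    HasWaringDecomposition (r + s + α) (binomialForm a b r s α) ((q + 1) * α + ε) := by
  obtain ⟨A, B, hA, hB, h, -⟩ := exists_apolarity_binomialForm hab r s hα
  have hz : -A / B ≠ 0 := div_ne_zero (neg_ne_zero.2 hA) hB
  have := h (geomPoly (-A / B) α (q + 1)) ε (separable_geomPoly hz hα) hε fun m hm => ?_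
  · rwa [natDegree_geomPoly hz hα] at this
  · rw [natDegree_geomPoly hz hα] at hm
    exact geomPoly_apolar hB hα hr hj (by omega)

/-- The factor `X` moves the failures to `t = 1` and `t = s + α + 1`; the factor at infinity makes
the window start at `2`. -/
theorem hasWaringDecomposition_X_mul_geomPoly (hab : a * b ≠ 0) (hα : 1 < α) (hs : s = q * α) :
    HasWaringDecomposition (s + s + α) (binomialForm a b s s α) (s + 2) := by
  obtain ⟨A, B, hA, hB, h, -⟩ := exists_apolarity_binomialForm hab s s hα.le
  have hz : -A / B ≠ 0 := div_ne_zero (neg_ne_zero.2 hA) hB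
  have h0 : (geomPoly (-A / B) α q).coeff 0 ≠ 0 := by
    rw [coeff_zero_geomPoly _ hα.le]
    exact one_ne_zero
  have hdeg : (X * geomPoly (-A / B) α q).natDegree = s + 1 := by
    rw [natDegree_X_mul (fun h => h0 (by rw [h, coeff_zero])), natDegree_geomPoly hz hα.le, hs]
  have := h (X * geomPoly (-A / B) α q) 1 (separable_X_mul (separable_geomPoly hz hα.le) h0) le_rfl
    fun m hm => ?_
  · rwa [hdeg] at this
  · rw [hdeg] at hm
    rw [hs]
    exact X_mul_geomPoly_apolar hB hα (by omega)

/-- The coefficients of an apolar form without multiple factors, extended by zero to the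
integers. -/
theorem exists_recurrence_of_hasWaringDecomposition (hab : a * b ≠ 0) (hα : 1 ≤ α) {k : ℕ}
    (hk : HasWaringDecomposition (r + s + α) (binomialForm a b r s α) k) :
    ∃ (A B : ℂ) (γ : ℤ → ℂ) (l : ℕ), A ≠ 0 ∧ B ≠ 0 ∧ l ≤ k ∧ (∀ t < 0, γ t = 0) ∧
      (∀ t > (l : ℤ), γ t = 0) ∧ (γ 0 ≠ 0 ∨ γ 1 ≠ 0) ∧ (γ l ≠ 0 ∨ γ (l - 1) ≠ 0) ∧
      ∀ t : ℤ, (l : ℤ) - s ≤ t → t ≤ r + α → A * γ (t - α) + B * γ t = 0 := by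
  obtain ⟨A, B, hA, hB, -, h⟩ := exists_apolarity_binomialForm hab r s hα
  obtain ⟨g, ε, hg, hε, hgk, hgr⟩ := h k hk
  have hlead : g.coeff g.natDegree ≠ 0 := leadingCoeff_ne_zero.2 hg.ne_zero
  refine ⟨A, B, fun t => if 0 ≤ t then g.coeff t.toNat else 0, g.natDegree + ε, hA, hB, hgk,
    fun t ht => if_neg (by omega), fun t ht => ?_, ?_, ?_, fun t ht ht' => ?_⟩
  · dsimp only
    rw [if_pos (by omega), coeff_eq_zero_of_natDegree_lt (by omega)]
  · simpa using hg.coeff_zero_ne_zero_or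
  -- The leading coefficient sits at index `l - ε`.
  · obtain rfl | rfl : ε = 0 ∨ ε = 1 := by omega
    · left
      dsimp only
      rw [if_pos (by omega)]
      simpa using hlead
    · right
      dsimp only
      rw [if_pos (by omega)]
      simpa using hlead
  · have h := hgr (r + α - t).toNat (by omega)
    rw [coeff_X_pow_mul', coeff_X_pow_mul'] at h
    have e1 : (if 0 ≤ t then g.coeff t.toNat else 0) = if (r + α - t).toNat ≤ r + α then
        g.coeff (r + α - (r + α - t).toNat) else 0 := by
      by_cases h0 : 0 ≤ t
      · rw [if_pos h0, if_pos (by omega)]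
        congr 1
        omega
      · rw [if_neg h0, if_neg (by omega)]
    have e2 : (if 0 ≤ t - α then g.coeff (t - α).toNat else 0) = if (r + α - t).toNat ≤ r then
        g.coeff (r - (r + α - t).toNat) else 0 := by
      by_cases h0 : 0 ≤ t - α
      · rw [if_pos h0, if_pos (by omega)]
        congr 1
        omega
      · rw [if_neg h0, if_neg (by omega)]
    simp only [e1, e2]
    exact h

end BinomialForm

theorem mainTheorem1 (a b : ℂ) (r s α q j : ℕ) (δ : ℤ)
    (hab : a * b ≠ 0) (hrs : r ≤ s) (hα : 1 ≤ α)
    (hr : r = q * α + j) (hj : j < α) (hδ : δ = (r : ℤ) + (α : ℤ) - (s : ℤ)) :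
    IsWaringRank (r + s + α) (binomialForm a b r s α)
      (if δ ≤ 0 then s + 1
        else if j = 0 ∧ r = s ∧ 1 < α then s + 2
        else if (j : ℤ) = δ then s + 1
        else if δ < (j : ℤ) then r + α + 1
        else r + α - j) := by
  have hq : (q + 1) * α = q * α + α := by ring
  refine ⟨isHomogeneous_binomialForm a b r s α, ?_, ?_⟩
  · change HasWaringDecomposition _ _ _
    split_ifs with h1 h2 h3 h4
    · exact hasWaringDecomposition_of_generic hab hα hr hj le_rfl (by omega)
    · obtain ⟨rfl, rfl, h2⟩ := h2
      exact hasWaringDecomposition_X_mul_geomPoly hab h2 hr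
    -- Here `s = (q + 1)α`, so a factor at infinity brings the degree to `s + 1`.
    · have := hasWaringDecomposition_geomPoly (s := s) hab hα hr hj (ε := 1) le_rfl (by omega)
      rwa [show (q + 1) * α + 1 = s + 1 by omega] at this
    · exact hasWaringDecomposition_of_generic hab hα hr hj (by omega) le_rfl
    · have := hasWaringDecomposition_geomPoly (s := s) hab hα hr hj (ε := 0) (by omega) (by omega)
      rwa [show (q + 1) * α + 0 = r + α - j by omega] at this
  · intro k hk
    obtain ⟨A, B, γ, l, hA, hB, hlk, hneg, hpos, h0, hl, hrec⟩ :=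
      exists_recurrence_of_hasWaringDecomposition hab hα hk
    have hs := succ_le_of_recurrence hB hα hneg h0 hrec
    refine le_trans ?_ hlk
    split_ifs with h1 h2 h3 h4
    · exact hs
    · obtain ⟨rfl, rfl, h2⟩ := h2
      exact add_two_le_of_recurrence hA hB h2 hr hneg hpos h0 hs hrec
    · exact hs
    · exact add_succ_le_of_recurrence hB hj hr (by omega) hneg hl hrec
    · exact sub_le_of_recurrence hA hB hrs hj hr (by omega) h2 hneg hpos h0 hl hs hrec
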